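/- Let $N \ge 1$ be an integer and let $P_N$ be the Legendre polynomial of degree $N$, $P_N(x) = \frac{1}{2^N N!}\frac{d^N}{dx^N}(x^2-1)^N$. The function $\theta \mapsto P_N(\cos\theta)$ has exactly $N$ distinct roots in $[0,\pi]$; denote them, in increasing order, by $\theta_0^{leg} < \theta_1^{leg} < \dots < \theta_{N-1}^{leg}$. For $0 \le k \le N-1$ let $$\theta_k^{cheb_*} = \frac{(k+\frac34)\pi}{N+\frac12}, \qquad \theta_k^{cheb_1} = \frac{(k+\frac12)\pi}{N}.$$ Then $$\max_{0\le k\le N-1}\left|\theta_k^{leg} - \theta_k^{cheb_*}\right| \le \frac{1}{3\pi(2N+1)} \le \frac{1}{6\pi N},$$ and $$\max_{0\le k\le N-1}\left|\theta_k^{leg} - \theta_k^{cheb_1}\right| \le \frac{3\pi^2+2}{6\pi(2N+1)} \le \frac{0.83845}{N}.$$ -/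

import Mathlib

open Polynomial

noncomputable section

/-- The Legendre polynomial of degree `n`, by Rodrigues' formula
`P_n = (1 / (2 ^ n * n!)) * (d/dX)^n (X ^ 2 - 1) ^ n`. -/
def legendreP (n : ℕ) : ℝ[X] :=
  C (1 / (2 ^ n * (n.factorial : ℝ))) * (derivative^[n] ((X ^ 2 - 1) ^ n))

/-- The angles `(k + 3/4) π / (N + 1/2)`, zeros of the leading term of the large-degree
asymptotic expansion of `P_N (cos θ)`. -/
def thetaChebStar (N k : ℕ) : ℝ :=
  ((k : ℝ) + 3 / 4) * Real.pi / ((N : ℝ) + 1 / 2)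

/-- The angles `(k + 1/2) π / N` of the Chebyshev points of the first kind. -/
def thetaChebOne (N k : ℕ) : ℝ :=
  ((k : ℝ) + 1 / 2) * Real.pi / (N : ℝ)

/-- `θ 0 < θ 1 < ... < θ (N - 1)` is the increasing enumeration of all the roots
`t ∈ [0, π]` of `P_N (cos t)`. -/
def IsLegendreAngles (N : ℕ) (θ : Fin N → ℝ) : Prop :=
  StrictMono θ ∧
    Set.range θ = {t : ℝ | t ∈ Set.Icc 0 Real.pi ∧ (legendreP N).eval (Real.cos t) = 0}

end

open Real

/-! Put M = N + 1/2 and let d_k be the error θ_k - θ_k^{cheb_*}. The Liouville substitution v =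
√(sin t) P_N(cos t) gives v'' + (M² + 1/(4 sin² t)) v = 0. This oscillates faster than w'' + M² w =
0, so consecutive angles differ by at most π/M (`legendre_sturm_pos`,
`IsLegendreAngles.succ_sub_le`). The comparison angles are spaced by exactly π/M, hence d is
decreasing. Parity of P_N makes d odd under k ↦ N-1-k, so |d_k| ≤ d_0.

It remains to bound θ_0 above: a truncated expansion of P_N at 1 is nonpositive before the angle
2.409/M (`exists_legendreP_nonpos`), and 2.409 < 3π/4 + 1/(6π). The bound for the Chebyshev points
of the first kind follows by the triangle inequality. -/

/-! ### Expansion at 1, parity and differential equation of P_n -/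

theorem iterate_derivative_comp_of_derivative_eq_C {R : Type*} [CommRing R] (p q : R[X]) (a : R)
    (hq : derivative q = C a) (k : ℕ) :
    derivative^[k] (p.comp q) = C (a ^ k) * (derivative^[k] p).comp q := by
  induction k with
  | zero => simp
  | succ k ih =>
    rw [Function.iterate_succ_apply', ih, derivative_C_mul, derivative_comp, hq,
      Function.iterate_succ_apply', pow_succ, C_mul]
    ring

/-- Substituting (1 - X)/2 turns X(1 - X) into -(X² - 1)/4, and each derivative contributes a factor
-1/2; the two Rodrigues formulas then agree. -/
theorem legendreP_eval_eq_shiftedLegendre (n : ℕ) (x : ℝ) :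
    (legendreP n).eval x = aeval ((1 - x) / 2) (shiftedLegendre n) := by
  have h := congrArg (Polynomial.map (Int.castRingHom ℝ)) (factorial_mul_shiftedLegendre_eq n)
  rw [← iterate_derivative_map] at h
  simp only [Polynomial.map_mul, Polynomial.map_natCast, Polynomial.map_pow, Polynomial.map_X,
    Polynomial.map_sub, Polynomial.map_one] at h
  set q : ℝ[X] := C (-1 / 2) * X + C (1 / 2) with hq
  have hdq : derivative q = C (-1 / 2) := by simp [hq]
  have h2 := iterate_derivative_comp_of_derivative_eq_C (X ^ n * (1 - X) ^ n : ℝ[X]) q _ hdq n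
  rw [← h] at h2
  have h3 : (X ^ n * (1 - X) ^ n : ℝ[X]).comp q = C ((-1 / 4) ^ n) * (X ^ 2 - 1) ^ n := by
    have h4 : q * (1 - q) = C (-1 / 4) * (X ^ 2 - 1) := by
      apply Polynomial.funext
      intro r
      simp [hq]
      ring
    simp only [mul_comp, pow_comp, X_comp, sub_comp, one_comp]
    rw [← mul_pow, h4, mul_pow, C_pow]
  rw [h3, iterate_derivative_C_mul] at h2
  have h4 := congrArg (eval x) h2
  have hqx : q.eval x = (1 - x) / 2 := by simp [hq]; ring
  simp only [eval_mul, eval_C, eval_comp, eval_natCast, hqx] at h4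
  have h5 : aeval ((1 - x) / 2) (shiftedLegendre n)
      = eval ((1 - x) / 2) (map (Int.castRingHom ℝ) (shiftedLegendre n)) := by
    rw [eval_map, aeval_def]; rfl
  rw [h5, legendreP, eval_mul, eval_C]
  have e1 : ((-1 / 4 : ℝ)) ^ n = (-1 / 2) ^ n * (1 / 2) ^ n := by rw [← mul_pow]; norm_num
  rw [e1, mul_assoc] at h4
  have h6 := mul_left_cancel₀ (pow_ne_zero n (by norm_num : (-1 / 2 : ℝ) ≠ 0)) h4
  rw [one_div, mul_inv, mul_assoc, mul_left_comm, ← inv_pow, ← one_div 2, h6]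
  have : (n.factorial : ℝ) ≠ 0 := by positivity
  field_simp

theorem legendreP_eval_eq_sum (n : ℕ) (x : ℝ) :
    (legendreP n).eval x = ∑ k ∈ Finset.range (n + 1),
      (-1) ^ k * ((n.choose k : ℝ) * ((n + k).choose n) * ((1 - x) / 2) ^ k) := by
  rw [legendreP_eval_eq_shiftedLegendre, shiftedLegendre, map_sum]
  refine Finset.sum_congr rfl fun k _ => ?_
  simp
  ring

theorem legendreP_eval_one (n : ℕ) : (legendreP n).eval 1 = 1 := by
  rw [legendreP_eval_eq_sum, Finset.sum_range_succ']
  simp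

theorem legendreP_ne_zero (n : ℕ) : legendreP n ≠ 0 := by
  intro h
  simpa [h] using legendreP_eval_one n

theorem legendreP_eval_neg (n : ℕ) (x : ℝ) :
    (legendreP n).eval (-x) = (-1) ^ n * (legendreP n).eval x := by
  rw [legendreP_eval_eq_shiftedLegendre, legendreP_eval_eq_shiftedLegendre,
    shiftedLegendre_eval_symm]
  congr 3
  ring

theorem natDegree_legendreP_le (n : ℕ) : (legendreP n).natDegree ≤ n := by
  refine (natDegree_C_mul_le _ _).trans ((natDegree_iterate_derivative _ _).trans ?_)
  have : ((X ^ 2 - 1 : ℝ[X]) ^ n).natDegree ≤ n * 2 := by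
    refine natDegree_pow_le.trans (Nat.mul_le_mul_left n ?_)
    compute_degree
  omega

/-- The Legendre differential equation. -/
theorem legendreP_ode (n : ℕ) :
    (1 - X ^ 2) * derivative^[2] (legendreP n) - 2 * X * derivative (legendreP n)
      + C ((n : ℝ) * (n + 1)) * legendreP n = 0 := by
  set f : ℝ[X] := (X ^ 2 - 1) ^ n with hf
  have hC2 : (C 2 : ℝ[X]) = 2 := map_ofNat C 2
  -- Differentiating this first-order relation n + 1 times, by Leibniz, gives the equation for the
  -- n-th derivative of f.
  have h1 : (X ^ 2 - 1) * derivative f = C (2 * (n : ℝ)) * (X * f) := by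
    rcases n with _ | n
    · simp [hf]
    · rw [hf, derivative_pow]
      simp [hC2]
      ring
  have h2 := congrArg derivative h1
  simp only [derivative_mul, derivative_C, derivative_X, derivative_sub, derivative_X_pow,
    derivative_one] at h2
  have h3 : derivative^[2] f * X ^ 2 + C (2 - 2 * (n : ℝ)) * (derivative f * X)
      = derivative^[2] f + C (2 * (n : ℝ)) * f := by
    have hC : C (2 - 2 * (n : ℝ)) = 2 - C (2 * (n : ℝ)) := by simp [hC2]
    simp only [Function.iterate_succ_apply, Function.iterate_zero_apply, hC]
    norm_num only [pow_one, Nat.cast_ofNat, map_ofNat] at h2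
    linear_combination h2
  have h4 := congrArg (derivative^[n]) h3
  rw [iterate_map_add, iterate_map_add, iterate_derivative_C_mul, iterate_derivative_C_mul,
    iterate_derivative_derivative_mul_X_sq, iterate_derivative_derivative_mul_X] at h4
  have h5 : derivative^[n] (derivative^[2] f) = derivative^[2] (derivative^[n] f) := by
    rw [← Function.iterate_add_apply, ← Function.iterate_add_apply, add_comm]
  have h6 : derivative^[n + 1] f = derivative (derivative^[n] f) :=
    Function.iterate_succ_apply' _ _ _
  have h7 : derivative^[n + 2] f = derivative^[2] (derivative^[n] f) := by
    rw [← Function.iterate_add_apply, add_comm]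
  have h8 : ((n * (n - 1) : ℕ) : ℝ[X]) = n * (n - 1) := by
    rcases n with _ | n <;> simp
  rw [h5, h6, h7, nsmul_eq_mul, nsmul_eq_mul, nsmul_eq_mul, h8] at h4
  rw [legendreP, ← hf, iterate_derivative_C_mul, derivative_C_mul]
  simp only [Nat.cast_mul, Nat.cast_ofNat, map_sub, map_mul, map_add, map_ofNat, map_natCast,
    map_one] at h4 ⊢
  linear_combination (-C (1 / (2 ^ n * (n.factorial : ℝ)))) * h4

/-! ### Alternating sums and the coefficient recurrence -/

theorem alternating_sum_bounds (n : ℕ) (b : ℕ → ℝ) (h0 : ∀ k, 0 ≤ b k) (hb : Antitone b) :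
    0 ≤ ∑ k ∈ Finset.range n, (-1) ^ k * b k ∧ ∑ k ∈ Finset.range n, (-1) ^ k * b k ≤ b 0 := by
  induction n generalizing b with
  | zero => simpa using h0 0
  | succ n ih =>
    obtain ⟨h1, h2⟩ := ih (fun k => b (k + 1)) (fun k => h0 _)
      (fun i j hij => hb (Nat.succ_le_succ hij))
    have h3 : ∑ k ∈ Finset.range (n + 1), (-1) ^ k * b k
        = b 0 - ∑ k ∈ Finset.range n, (-1) ^ k * b (k + 1) := by
      rw [Finset.sum_range_succ', sub_eq_add_neg, ← Finset.sum_neg_distrib, add_comm]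
      congr 1
      · simp
      · exact Finset.sum_congr rfl fun k _ => by ring
    have h4 : b (0 + 1) ≤ b 0 := hb (Nat.zero_le _)
    rw [h3]
    constructor <;> linarith

/-- This ratio controls the decay of the terms of the expansion and expresses its coefficients as
polynomials in n(n + 1). -/
theorem legendre_coeff_succ (n k : ℕ) :
    ((k : ℝ) + 1) ^ 2 * ((n.choose (k + 1) : ℝ) * ((n + (k + 1)).choose n))
      = ((n : ℝ) * (n + 1) - k * (k + 1)) * ((n.choose k : ℝ) * ((n + k).choose n)) := by
  have h1 : ((k : ℝ) + 1) * n.choose (k + 1) = (n - k) * n.choose k := by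
    rcases le_or_gt k n with h | h
    · have := Nat.choose_succ_right_eq n k
      have := congrArg (Nat.cast : ℕ → ℝ) this
      push_cast [Nat.cast_sub h] at this
      linarith
    · simp [Nat.choose_eq_zero_of_lt h, Nat.choose_eq_zero_of_lt (Nat.lt_succ_of_lt h)]
  have h2 : ((k : ℝ) + 1) * ((n + (k + 1)).choose n) = (n + k + 1) * ((n + k).choose n) := by
    have := Nat.add_one_mul_choose_eq (n + k) k
    have e1 : (n + (k + 1)).choose n = (n + k).succ.choose k.succ := by
      exact Nat.choose_symm_add
    have e2 : (n + k).choose n = (n + k).choose k := Nat.choose_symm_add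
    rw [e1, e2]
    have := congrArg (Nat.cast : ℕ → ℝ) this
    push_cast at this ⊢
    linarith
  calc _ = (((k : ℝ) + 1) * n.choose (k + 1)) * (((k : ℝ) + 1) * ((n + (k + 1)).choose n)) := by
        ring
    _ = _ := by rw [h1, h2]; ring

/-! ### Sturm comparison -/

/-- Sturm comparison: between consecutive zeros of `sin ((n + 1/2) (t - a))` inside `(0, π)`, any
solution `y` of `sin t y'' + cos t y' + n (n + 1) sin t y = 0` vanishes; stated for a
positive solution. -/
theorem legendre_sturm_pos (M : ℝ) (hM : 0 < M) (y y' y'' : ℝ → ℝ)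
    (hy : ∀ t, HasDerivAt y (y' t) t) (hy' : ∀ t, HasDerivAt y' (y'' t) t)
    (hode : ∀ t, sin t * y'' t + cos t * y' t + (M ^ 2 - 1 / 4) * sin t * y t = 0)
    (a : ℝ) (ha : 0 < a) (hb : a + π / M < π) (hpos : ∀ t ∈ Set.Ioo a (a + π / M), 0 < y t) :
    False := by
  have hpM : 0 < π / M := by positivity
  set b := a + π / M with hbdef
  have hab : a < b := by linarith
  have hsin : ∀ t ∈ Set.Icc a b, 0 < sin t := fun t ht =>
    sin_pos_of_pos_of_lt_pi (ha.trans_le ht.1) (ht.2.trans_lt hb)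
  -- The Wronskian v w' - v' w of v = √(sin t) y and w = sin (M (t - a)). Its derivative v w / (4
  -- sin² t) is positive inside, yet W(a) = M v(a) ≥ 0 and W(b) = -M v(b) ≤ 0.
  set W : ℝ → ℝ := fun t => √(sin t) * (y t * (M * cos (M * (t - a)))
    - (cos t / sin t / 2 * y t + y' t) * sin (M * (t - a))) with hW
  have hyc : ContinuousOn y (Set.Icc a b) := fun t _ => (hy t).continuousAt.continuousWithinAt
  have hclos : ∀ t ∈ Set.Icc a b, 0 ≤ y t := by
    have hcl : closure (Set.Ioo a b) = Set.Icc a b := closure_Ioo hab.ne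
    intro t ht
    rw [← hcl] at ht hyc
    exact hyc.image_closure.trans (closure_minimal (t := Set.Ici 0)
      (by rintro _ ⟨s, hs, rfl⟩; exact (hpos s hs).le) isClosed_Ici) ⟨t, ht, rfl⟩
  have hder : ∀ t ∈ Set.Icc a b, HasDerivAt W
      (√(sin t) * y t * sin (M * (t - a)) / (4 * sin t ^ 2)) t := by
    intro t ht
    have hs := hsin t ht
    have d1 : HasDerivAt (fun t => √(sin t)) (cos t / (2 * √(sin t))) t :=
      (hasDerivAt_sin t).sqrt hs.ne'
    have dl : HasDerivAt (fun t => M * (t - a)) M t := by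
      simpa using ((hasDerivAt_id t).sub_const a).const_mul M
    have d2 := dl.sin
    have d3 := dl.cos
    have d4 := ((hasDerivAt_cos t).div (hasDerivAt_sin t) hs.ne').div_const 2
    have d5 := d1.mul (((hy t).mul (d3.const_mul M)).sub (((d4.mul (hy t)).add (hy' t)).mul d2))
    refine d5.congr_deriv ?_
    have hq : √(sin t) ^ 2 = sin t := sq_sqrt hs.le
    have hq0 : √(sin t) ≠ 0 := (sqrt_pos.2 hs).ne'
    have hc : cos t ^ 2 = 1 - sin t ^ 2 := by rw [cos_sq']
    have ho : y'' t = - (cos t * y' t) / sin t - (M ^ 2 - 1 / 4) * y t := by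
      have := hode t
      field_simp
      linarith
    have e1 : cos t / (2 * √(sin t)) = √(sin t) * (cos t / (2 * sin t)) := by
      field_simp
      rw [hq]
    simp only [Pi.add_apply, Pi.mul_apply, Pi.div_apply, Pi.sub_apply]
    rw [e1, ho]
    have hs' := hs.ne'
    field_simp
    ring_nf
    simp only [hc]
    ring
  have hmono : StrictMonoOn W (Set.Icc a b) := by
    apply strictMonoOn_of_deriv_pos (convex_Icc a b)
    · exact fun t ht => (hder t ht).continuousAt.continuousWithinAt
    · intro t ht
      rw [interior_Icc] at ht
      have ht' := Set.Ioo_subset_Icc_self ht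
      rw [(hder t ht').deriv]
      have h1 := hsin t ht'
      have h2 := hpos t ht
      have h3 : 0 < sin (M * (t - a)) := by
        apply sin_pos_of_pos_of_lt_pi
        · exact mul_pos hM (sub_pos.2 ht.1)
        · have : t - a < π / M := by linarith [ht.2]
          rw [lt_div_iff₀ hM] at this
          linarith
      positivity
  have hlt := hmono (Set.left_mem_Icc.2 hab.le) (Set.right_mem_Icc.2 hab.le) hab
  have hMb : M * (b - a) = π := by rw [hbdef]; field_simp; ring
  have hWa : 0 ≤ W a := by
    have := hclos a (Set.left_mem_Icc.2 hab.le)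
    simp only [hW, sub_self, mul_zero, cos_zero, sin_zero, mul_one, sub_zero]
    positivity
  have hWb : W b ≤ 0 := by
    have := hclos b (Set.right_mem_Icc.2 hab.le)
    simp only [hW, hMb, cos_pi, sin_pi, mul_zero, sub_zero]
    have : 0 ≤ √(sin b) * (y b * M) := by positivity
    linarith
  linarith

/-! ### Upper bound for the smallest angle -/

/-- From k = 5 on, consecutive terms have ratio at most n(n + 1)s/(k + 1)² ≤ 36/36, so the omitted
alternating tail, which starts with a minus sign, is nonpositive. -/
theorem legendreP_eval_le_truncation (n : ℕ) (s : ℝ) (hs : 0 ≤ s)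
    (hns : (n : ℝ) * (n + 1) * s ≤ 36) :
    (legendreP n).eval (1 - 2 * s) ≤ ∑ k ∈ Finset.range 5,
      (-1) ^ k * ((n.choose k : ℝ) * ((n + k).choose n) * s ^ k) := by
  set b : ℕ → ℝ := fun k => (n.choose k : ℝ) * ((n + k).choose n) * s ^ k with hb
  have hb0 : ∀ k, 0 ≤ b k := fun k => by positivity
  -- Padding with vanishing terms lets five terms be split off even when n < 4.
  have e1 : (legendreP n).eval (1 - 2 * s) = ∑ k ∈ Finset.range (5 + (n + 1)), (-1) ^ k * b k := by
    have : (1 - (1 - 2 * s)) / 2 = s := by ring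
    rw [legendreP_eval_eq_sum, this]
    refine Finset.sum_subset (fun k hk => ?_) fun k _ hk => ?_
    · rw [Finset.mem_range] at hk ⊢
      omega
    · rw [Finset.mem_range, not_lt] at hk
      simp [Nat.choose_eq_zero_of_lt (show n < k by omega)]
  have hanti : Antitone fun k => b (5 + k) := by
    refine antitone_nat_of_succ_le fun j => ?_
    have h := legendre_coeff_succ n (5 + j)
    have h2 : ((((5 + j : ℕ) : ℝ)) + 1) ^ 2 * b (5 + j + 1)
        = ((n : ℝ) * (n + 1) * s - ((5 + j : ℕ) : ℝ) * ((5 + j : ℕ) + 1) * s) * b (5 + j) := by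
      simp only [hb]
      rw [← mul_assoc, h]
      ring
    have h3 : (36 : ℝ) ≤ (((5 + j : ℕ) : ℝ) + 1) ^ 2 := by
      push_cast
      nlinarith [(Nat.cast_nonneg j : (0 : ℝ) ≤ j)]
    have h4 : 0 ≤ ((5 + j : ℕ) : ℝ) * ((5 + j : ℕ) + 1) * s := by positivity
    have h5 : (((5 + j : ℕ) : ℝ) + 1) ^ 2 * b (5 + j + 1)
        ≤ (((5 + j : ℕ) : ℝ) + 1) ^ 2 * b (5 + j) := by
      rw [h2]
      exact mul_le_mul_of_nonneg_right (by linarith) (hb0 _)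
    exact le_of_mul_le_mul_left h5 (by positivity)
  have h6 := (alternating_sum_bounds (n + 1) _ (fun k => hb0 (5 + k)) hanti).1
  rw [e1, Finset.sum_range_add]
  have h7 : ∑ k ∈ Finset.range (n + 1), (-1) ^ (5 + k) * b (5 + k)
      = -∑ k ∈ Finset.range (n + 1), (-1) ^ k * b (5 + k) := by
    rw [← Finset.sum_neg_distrib]
    exact Finset.sum_congr rfl fun k _ => by ring
  rw [h7]
  linarith

theorem legendreP_eval_le_quartic (n : ℕ) (s l : ℝ) (hl : l = (n : ℝ) * (n + 1)) (hs : 0 ≤ s)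
    (hls : l * s ≤ 36) :
    (legendreP n).eval (1 - 2 * s) ≤ 1 - l * s + l * (l - 2) * s ^ 2 / 4
      - l * (l - 2) * (l - 6) * s ^ 3 / 36 + l * (l - 2) * (l - 6) * (l - 12) * s ^ 4 / 576 := by
  refine (legendreP_eval_le_truncation n s hs (hl ▸ hls)).trans_eq ?_
  have c0 := legendre_coeff_succ n 0
  have c1 := legendre_coeff_succ n 1
  have c2 := legendre_coeff_succ n 2
  have c3 := legendre_coeff_succ n 3
  simp only [← hl] at c0 c1 c2 c3
  norm_num at c0 c1 c2 c3
  simp only [Finset.sum_range_succ, Finset.sum_range_zero]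
  norm_num
  linear_combination (-s + (l - 2) * s ^ 2 / 4 - (l - 2) * (l - 6) * s ^ 3 / 36
      + (l - 2) * (l - 6) * (l - 12) * s ^ 4 / 576) * c0
    + (s ^ 2 / 4 - (l - 6) * s ^ 3 / 36 + (l - 6) * (l - 12) * s ^ 4 / 576) * c1
    + (-s ^ 3 / 9 + (l - 12) * s ^ 4 / 144) * c2 + (s ^ 4 / 16) * c3

/-- Since cos φ = 1 - 2 sin²(φ/2), the bound on s places 1 - 2s at or to the right of cos(2.409/(n +
1/2)). The constant lies between the first zero 2.4048… of the Bessel function J₀, which governs the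
limit, and 3π/4 + 1/(6π) ≈ 2.40924. -/
theorem exists_legendreP_nonpos (n : ℕ) (hn : 1 ≤ n) : ∃ s : ℝ, 0 ≤ s ∧
    s ≤ sin (2.409 / ((n : ℝ) + 1 / 2) / 2) ^ 2 ∧ (legendreP n).eval (1 - 2 * s) ≤ 0 := by
  have key : ∀ s : ℝ, ∀ x : ℝ, x = 2.409 / ((n : ℝ) + 1 / 2) / 2 → 0 ≤ x → x ^ 2 ≤ 6 →
      s ≤ x ^ 2 * (1 - x ^ 2 / 6) ^ 2 → s ≤ sin (2.409 / ((n : ℝ) + 1 / 2) / 2) ^ 2 := by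
    intro s x hx hx0 hx6 h
    rw [← hx]
    have h1 := sin_ge_sub_cube hx0
    have h2 : 0 ≤ x - x ^ 3 / 6 := by
      have : x - x ^ 3 / 6 = x * (1 - x ^ 2 / 6) := by ring
      rw [this]
      exact mul_nonneg hx0 (by linarith)
    calc s ≤ (x - x ^ 3 / 6) ^ 2 := by linarith
      _ ≤ _ := pow_le_pow_left₀ h2 h1 2
  obtain rfl | rfl | hn3 : n = 1 ∨ n = 2 ∨ 3 ≤ n := by omega
  · refine ⟨1 / 2, by norm_num, key _ 0.803 ?_ ?_ ?_ ?_,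
      (legendreP_eval_le_quartic 1 (1 / 2) 2 ?_ ?_ ?_).trans ?_⟩ <;> norm_num
  · refine ⟨0.214, by norm_num, key _ 0.4818 ?_ ?_ ?_ ?_,
      (legendreP_eval_le_quartic 2 0.214 6 ?_ ?_ ?_).trans ?_⟩ <;> norm_num
  · have hn' : (3 : ℝ) ≤ n := by exact_mod_cast hn3
    -- The shift makes u ≥ 0 for n ≥ 3, so the polynomial inequalities below follow from
    -- nonnegativity of powers of u.
    obtain ⟨u, hu⟩ : ∃ u : ℝ, u = (n : ℝ) * (n + 1) - 12 := ⟨_, rfl⟩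
    have hu0 : 0 ≤ u := by nlinarith
    have hM : ((n : ℝ) + 1 / 2) ^ 2 = u + 49 / 4 := by rw [hu]; ring
    have hD : 0 < u + 51 / 4 := by linarith
    have hE : 0 < u + 49 / 4 := by linarith
    -- The denominator is (n + 1/2)² + 1/2. Here 1.45 is just below 2.409²/4, and the limiting
    -- quartic 1 - x + x²/4 - x³/36 + x⁴/576 is already negative there; the extra 1/2 absorbs the
    -- cubic loss in sin x ≥ x - x³/6.
    refine ⟨1.45 / (u + 51 / 4), by positivity, key _ _ rfl (by positivity) ?_ ?_,
      (legendreP_eval_le_quartic n _ (u + 12) (by linarith) (by positivity) ?_).trans ?_⟩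
    · rw [div_pow, div_pow, hM, div_div, div_le_iff₀ (by positivity)]
      linarith
    · rw [div_pow, div_pow, hM, div_div, div_le_iff₀ hD]
      have : 2.409 ^ 2 / ((u + 49 / 4) * 2 ^ 2)
          * (1 - 2.409 ^ 2 / ((u + 49 / 4) * 2 ^ 2) / 6) ^ 2 * (u + 51 / 4)
          = 2.409 ^ 2 / 4 * (u + 49 / 4 - 2.409 ^ 2 / 24) ^ 2 * (u + 51 / 4)
            / (u + 49 / 4) ^ 3 := by
        field_simp
        ring
      rw [this, le_div_iff₀ (by positivity)]
      have h2 : 0 ≤ u ^ 2 := by positivity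
      have h3 : 0 ≤ u ^ 3 := by positivity
      ring_nf
      linarith
    · rw [← mul_div_assoc, div_le_iff₀ hD]
      linarith
    · have : ∀ l D : ℝ, D ≠ 0 → 1 - l * (1.45 / D) + l * (l - 2) * (1.45 / D) ^ 2 / 4
          - l * (l - 2) * (l - 6) * (1.45 / D) ^ 3 / 36
          + l * (l - 2) * (l - 6) * (l - 12) * (1.45 / D) ^ 4 / 576
          = (D ^ 4 - l * 1.45 * D ^ 3 + l * (l - 2) * 1.45 ^ 2 / 4 * D ^ 2
          - l * (l - 2) * (l - 6) * 1.45 ^ 3 / 36 * D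
          + l * (l - 2) * (l - 6) * (l - 12) * 1.45 ^ 4 / 576) / D ^ 4 := by
        intro l D hD
        field_simp
      rw [this _ _ hD.ne']
      refine div_nonpos_of_nonpos_of_nonneg ?_ (by positivity)
      have h2 : 0 ≤ u ^ 2 := by positivity
      have h3 : 0 ≤ u ^ 3 := by positivity
      have h4 : 0 ≤ u ^ 4 := by positivity
      ring_nf
      linarith

theorem exists_small_legendre_angle (n : ℕ) (hn : 1 ≤ n) : ∃ t ∈ Set.Icc 0 π,
    t ≤ (3 * π / 4 + 1 / (6 * π)) / ((n : ℝ) + 1 / 2) ∧ (legendreP n).eval (cos t) = 0 := by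
  obtain ⟨s, hs0, hs, hle⟩ := exists_legendreP_nonpos n hn
  have hn' : (1 : ℝ) ≤ n := by exact_mod_cast hn
  obtain ⟨x, hx, hx0⟩ := intermediate_value_Icc (show 1 - 2 * s ≤ 1 by linarith)
    (legendreP n).continuous.continuousOn ⟨hle, by rw [legendreP_eval_one]; norm_num⟩
  have hsin : sin (2.409 / ((n : ℝ) + 1 / 2) / 2) ^ 2 ≤ 1 := sin_sq_le_one _
  refine ⟨arccos x, ⟨arccos_nonneg x, arccos_le_pi x⟩, ?_, ?_⟩
  · have h1 : arccos x ≤ 2.409 / ((n : ℝ) + 1 / 2) := by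
      have h0 : 0 ≤ 2.409 / ((n : ℝ) + 1 / 2) := by positivity
      have hpi : 2.409 / ((n : ℝ) + 1 / 2) ≤ π := by
        rw [div_le_iff₀ (by positivity)]
        nlinarith [pi_gt_three]
      rw [← arccos_cos h0 hpi]
      refine arccos_le_arccos (le_trans ?_ hx.1)
      have : cos (2.409 / ((n : ℝ) + 1 / 2))
          = 1 - 2 * sin (2.409 / ((n : ℝ) + 1 / 2) / 2) ^ 2 := by
        rw [← cos_two_mul_eq_one_sub, mul_div_cancel₀ _ two_ne_zero]
      rw [this]
      linarith
    refine h1.trans ?_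
    gcongr
    have h2 : (0.053 : ℝ) ≤ 1 / (6 * π) := by
      rw [le_div_iff₀ (by positivity)]
      linarith [pi_lt_d6]
    linarith [pi_gt_d6]
  · rw [cos_arccos (by linarith [hx.1]) hx.2]
    exact hx0

/-! ### Existence, enumeration and spacing of the angles -/

/-- Without a zero, P_n(cos t) has constant sign on the interval, and Sturm comparison applies to it
or to its negative. -/
theorem exists_legendre_angle_between (n : ℕ) (a : ℝ) (ha : 0 < a)
    (hb : a + π / ((n : ℝ) + 1 / 2) < π) :
    ∃ t ∈ Set.Ioo a (a + π / ((n : ℝ) + 1 / 2)), (legendreP n).eval (cos t) = 0 := by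
  by_contra! hne
  set M : ℝ := (n : ℝ) + 1 / 2 with hM
  have hM0 : 0 < M := by positivity
  set p := legendreP n with hp
  have hy : ∀ t, HasDerivAt (fun t => p.eval (cos t)) (-sin t * (derivative p).eval (cos t)) t :=
    fun t => ((p.hasDerivAt (cos t)).comp t (hasDerivAt_cos t)).congr_deriv (by ring)
  have hy' : ∀ t, HasDerivAt (fun t => -sin t * (derivative p).eval (cos t))
      (-cos t * (derivative p).eval (cos t)
        + sin t ^ 2 * (derivative^[2] p).eval (cos t)) t := by
    intro t
    refine ((hasDerivAt_sin t).neg.mul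
      (((derivative p).hasDerivAt (cos t)).comp t (hasDerivAt_cos t))).congr_deriv ?_
    simp only [Function.iterate_succ_apply, Function.iterate_zero_apply, Pi.neg_apply,
      Function.comp_apply]
    ring
  have hode : ∀ t, sin t * (-cos t * (derivative p).eval (cos t)
        + sin t ^ 2 * (derivative^[2] p).eval (cos t))
      + cos t * (-sin t * (derivative p).eval (cos t))
      + (M ^ 2 - 1 / 4) * sin t * p.eval (cos t) = 0 := by
    intro t
    have h := congrArg (eval (cos t)) (legendreP_ode n)
    simp only [eval_add, eval_sub, eval_mul, eval_pow, eval_X, eval_one, eval_C, eval_zero,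
      eval_ofNat] at h
    rw [← hp, ← sin_sq] at h
    have hM2 : M ^ 2 - 1 / 4 = n * (n + 1) := by rw [hM]; ring
    rw [hM2]
    linear_combination sin t * h
  have hcont : ContinuousOn (fun t => p.eval (cos t)) (Set.Ioo a (a + π / M)) :=
    fun t _ => (hy t).continuousAt.continuousWithinAt
  have hsign : (∀ t ∈ Set.Ioo a (a + π / M), 0 < p.eval (cos t)) ∨
      ∀ t ∈ Set.Ioo a (a + π / M), p.eval (cos t) < 0 := by
    by_contra! hcon
    obtain ⟨⟨r, hr, hr0⟩, ⟨q, hq, hq0⟩⟩ := hcon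
    obtain ⟨z, hz, hz0⟩ := isPreconnected_Ioo.intermediate_value hr hq hcont ⟨hr0, hq0⟩
    exact hne z hz hz0
  rcases hsign with h | h
  · exact legendre_sturm_pos M hM0 _ _ _ hy hy' hode a ha hb h
  · refine legendre_sturm_pos M hM0 _ _ _ (fun t => (hy t).neg) (fun t => (hy' t).neg)
      (fun t => ?_) a ha hb fun t ht => neg_pos.2 (h t ht)
    simp only [Pi.neg_apply]
    linear_combination -hode t

theorem legendre_angles_ncard_le (n : ℕ) :
    {t : ℝ | t ∈ Set.Icc 0 π ∧ (legendreP n).eval (cos t) = 0}.Finite ∧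
    {t : ℝ | t ∈ Set.Icc 0 π ∧ (legendreP n).eval (cos t) = 0}.ncard ≤ n := by
  have hmaps : Set.MapsTo cos {t : ℝ | t ∈ Set.Icc 0 π ∧ (legendreP n).eval (cos t) = 0}
      ((legendreP n).roots.toFinset : Set ℝ) := by
    rintro t ⟨-, ht⟩
    simpa [legendreP_ne_zero n] using ht
  have hinj : Set.InjOn cos {t : ℝ | t ∈ Set.Icc 0 π ∧ (legendreP n).eval (cos t) = 0} :=
    injOn_cos.mono fun t ht => ht.1
  refine ⟨Set.Finite.of_injOn hmaps hinj (Finset.finite_toSet _), ?_⟩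
  refine (Set.ncard_le_ncard_of_injOn cos hmaps hinj (Finset.finite_toSet _)).trans ?_
  rw [Set.ncard_coe_finset]
  exact (Multiset.toFinset_card_le _).trans ((card_roots' _).trans (natDegree_legendreP_le n))

theorem IsLegendreAngles.unique {n : ℕ} {θ φ : Fin n → ℝ} (hθ : IsLegendreAngles n θ)
    (hφ : IsLegendreAngles n φ) : θ = φ :=
  (hθ.1.range_inj hφ.1).1 (hθ.2.trans hφ.2.symm)

theorem exists_isLegendreAngles (n : ℕ) : ∃ θ : Fin n → ℝ, IsLegendreAngles n θ := by
  set M : ℝ := (n : ℝ) + 1 / 2 with hM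
  have hM0 : 0 < M := by positivity
  have hMM : M * (π / M) = π := by field_simp
  have hpM : 0 < π / M := by positivity
  -- These n disjoint intervals already produce as many zeros as the degree allows. Any offset
  -- strictly between 0 and 1/2 would keep them inside (0, π), as M = n + 1/2.
  have hex : ∀ j : Fin n, ∃ t ∈ Set.Ioo (((j : ℝ) + 1 / 4) * (π / M))
      (((j : ℝ) + 1 / 4) * (π / M) + π / M),
      (legendreP n).eval (cos t) = 0 := by
    intro j
    refine exists_legendre_angle_between n _ (by positivity) ?_
    rw [← hM]
    have hj : (j : ℝ) + 1 ≤ n := by exact_mod_cast j.2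
    calc ((j : ℝ) + 1 / 4) * (π / M) + π / M = ((j : ℝ) + 1 + 1 / 4) * (π / M) := by ring
      _ < M * (π / M) := by
        apply mul_lt_mul_of_pos_right _ hpM
        rw [hM]
        linarith
      _ = π := hMM
  choose z hz hz0 using hex
  have hmono : StrictMono z := by
    intro i j hij
    have hij' : (i : ℝ) + 1 ≤ j := by exact_mod_cast hij
    have := mul_le_mul_of_nonneg_right hij' hpM.le
    linarith [(hz i).2, (hz j).1]
  have hsub : Set.range z ⊆ {t : ℝ | t ∈ Set.Icc 0 π ∧ (legendreP n).eval (cos t) = 0} := by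
    rintro _ ⟨j, rfl⟩
    have hj : (j : ℝ) + 1 ≤ n := by exact_mod_cast j.2
    refine ⟨⟨?_, ?_⟩, hz0 j⟩
    · have : 0 ≤ ((j : ℝ) + 1 / 4) * (π / M) := by positivity
      linarith [(hz j).1]
    · have : ((j : ℝ) + 1 + 1 / 4) * (π / M) ≤ M * (π / M) := by
        apply mul_le_mul_of_nonneg_right _ hpM.le
        rw [hM]
        linarith
      linarith [(hz j).2]
  obtain ⟨hfin, hcard⟩ := legendre_angles_ncard_le n
  refine ⟨z, hmono, Set.eq_of_subset_of_ncard_le hsub ?_ hfin⟩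
  rwa [← Set.image_univ, Set.ncard_image_of_injective _ hmono.injective, Set.ncard_univ,
    Nat.card_eq_fintype_card, Fintype.card_fin]

/-- By parity of P_n, reflecting and reversing an enumeration gives another one; uniqueness
identifies them. -/
theorem IsLegendreAngles.reflect {n : ℕ} {θ : Fin n → ℝ} (hθ : IsLegendreAngles n θ)
    (k : Fin n) : θ k.rev = π - θ k := by
  have h : IsLegendreAngles n fun k => π - θ k.rev := by
    refine ⟨fun i j hij => ?_, ?_⟩
    · have := hθ.1 (Fin.rev_lt_rev.2 hij)
      simp only
      linarith
    · have hmem : ∀ t, t ∈ Set.range θ ↔ t ∈ Set.Icc 0 π ∧ (legendreP n).eval (cos t) = 0 :=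
        fun t => by rw [hθ.2]; rfl
      ext t
      have h1 : (t ∈ Set.range fun k : Fin n => π - θ k.rev) ↔ π - t ∈ Set.range θ := by
        constructor
        · rintro ⟨j, rfl⟩
          exact ⟨j.rev, by ring⟩
        · rintro ⟨j, hj⟩
          exact ⟨j.rev, by simp [hj]⟩
      rw [h1, hmem, cos_pi_sub, legendreP_eval_neg]
      simp only [Set.mem_Icc, Set.mem_ofPred_eq, mul_eq_zero, pow_eq_zero_iff', neg_eq_zero,
        one_ne_zero, false_and, false_or]
      constructor <;> rintro ⟨⟨h2, h3⟩, h4⟩ <;> exact ⟨⟨by linarith, by linarith⟩, h4⟩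
  have := congrFun (h.unique hθ) k
  linarith

theorem IsLegendreAngles.succ_sub_le {n : ℕ} {θ : Fin n → ℝ} (hθ : IsLegendreAngles n θ)
    {i j : Fin n} (hij : (j : ℕ) = i + 1) : θ j - θ i ≤ π / ((n : ℝ) + 1 / 2) := by
  have hmem : ∀ k, θ k ∈ Set.Icc 0 π ∧ (legendreP n).eval (cos (θ k)) = 0 := fun k => by
    have : θ k ∈ Set.range θ := ⟨k, rfl⟩
    rwa [hθ.2] at this
  -- Sturm comparison needs a left endpoint away from the singularity at 0; P_n(1) = 1 excludes that
  -- value.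
  have hpos : 0 < θ i := by
    refine (hmem i).1.1.lt_of_ne fun h0 => ?_
    have := (hmem i).2
    rw [← h0, cos_zero, legendreP_eval_one] at this
    exact one_ne_zero this
  rcases le_or_gt π (θ i + π / ((n : ℝ) + 1 / 2)) with h | h
  · linarith [(hmem j).1.2]
  · obtain ⟨t, ht, ht0⟩ := exists_legendre_angle_between n (θ i) hpos h
    have : t ∈ Set.range θ := by
      rw [hθ.2]
      exact ⟨⟨by linarith [ht.1], by linarith [ht.2]⟩, ht0⟩
    obtain ⟨k, rfl⟩ := this
    have hik : i < k := hθ.1.lt_iff_lt.1 ht.1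
    have hjk : j ≤ k := by
      rw [Fin.lt_def] at hik
      rw [Fin.le_def]
      omega
    linarith [hθ.1.monotone hjk, ht.2]

theorem IsLegendreAngles.zero_le {n : ℕ} {θ : Fin (n + 1) → ℝ}
    (hθ : IsLegendreAngles (n + 1) θ) :
    θ 0 ≤ (3 * π / 4 + 1 / (6 * π)) / (((n + 1 : ℕ) : ℝ) + 1 / 2) := by
  obtain ⟨t, ht, hle, ht0⟩ := exists_small_legendre_angle (n + 1) (by omega)
  have : t ∈ Set.range θ := by
    rw [hθ.2]
    exact ⟨ht, ht0⟩
  obtain ⟨k, rfl⟩ := this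
  exact (hθ.1.monotone (Fin.zero_le k)).trans hle

/-! ### Error bounds and numerical constants -/

theorem IsLegendreAngles.abs_sub_thetaChebStar_le {n : ℕ} {θ : Fin n → ℝ}
    (hθ : IsLegendreAngles n θ) (k : Fin n) :
    |θ k - thetaChebStar n k| ≤ 1 / (3 * π * (2 * (n : ℝ) + 1)) := by
  rcases n with _ | n
  · exact k.elim0
  set M : ℝ := ((n + 1 : ℕ) : ℝ) + 1 / 2 with hM
  have hM0 : 0 < M := by positivity
  set d : Fin (n + 1) → ℝ := fun k => θ k - thetaChebStar (n + 1) k with hd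
  have hanti : Antitone d := by
    rw [Fin.antitone_iff_succ_le]
    intro i
    have h := hθ.succ_sub_le (i := i.castSucc) (j := i.succ) (by simp)
    have h2 : thetaChebStar (n + 1) i.succ = thetaChebStar (n + 1) i.castSucc + π / M := by
      simp only [thetaChebStar, Fin.val_succ, Fin.val_castSucc, ← hM]
      push_cast
      field_simp
      ring
    simp only [hd, h2]
    linarith
  have hrev : ∀ k, d k.rev = -d k := by
    intro k
    have hk : ((k.rev : ℕ) : ℝ) = n - k := by
      rw [Fin.val_rev, Nat.add_sub_add_right, Nat.cast_sub (Nat.lt_succ_iff.1 k.2)]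
    have h2 : thetaChebStar (n + 1) k.rev = π - thetaChebStar (n + 1) k := by
      simp only [thetaChebStar, hk, ← hM]
      rw [eq_sub_iff_add_eq, ← add_div, div_eq_iff hM0.ne', hM]
      push_cast
      ring
    simp only [hd, hθ.reflect k, h2]
    ring
  have hd0 : d 0 ≤ 1 / (3 * π * (2 * ((n + 1 : ℕ) : ℝ) + 1)) := by
    have h1 := hθ.zero_le
    have h2 : (3 * π / 4 + 1 / (6 * π)) / M - thetaChebStar (n + 1) 0
        = 1 / (3 * π * (2 * ((n + 1 : ℕ) : ℝ) + 1)) := by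
      have : 2 * ((n + 1 : ℕ) : ℝ) + 1 = 2 * M := by rw [hM]; ring
      rw [this]
      simp only [thetaChebStar, ← hM, Nat.cast_zero]
      field_simp
      ring
    simp only [hd, Fin.val_zero]
    rw [← h2]
    linarith
  have hk1 := hanti (Fin.zero_le k)
  -- Oddness under reversal turns the upper bound at `k.rev` into the lower bound at `k`.
  have hk2 := hanti (Fin.zero_le k.rev)
  rw [hrev] at hk2
  change |d k| ≤ _
  rw [abs_le]
  constructor <;> linarith

theorem abs_thetaChebStar_sub_thetaChebOne_le {n k : ℕ} (hk : k < n) :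
    |thetaChebStar n k - thetaChebOne n k| ≤ π / (2 * (2 * (n : ℝ) + 1)) := by
  have hn : (1 : ℝ) ≤ n := by exact_mod_cast (show 1 ≤ n by omega)
  have hk' : (k : ℝ) + 1 ≤ n := by exact_mod_cast hk
  have h : thetaChebStar n k - thetaChebOne n k
      = π / (2 * (2 * (n : ℝ) + 1)) * ((n - 2 * k - 1) / n) := by
    unfold thetaChebStar thetaChebOne
    field_simp
    ring
  have h1 : |((n : ℝ) - 2 * k - 1) / n| ≤ 1 := by
    rw [abs_le, le_div_iff₀ (by linarith), div_le_iff₀ (by linarith)]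
    have : (0 : ℝ) ≤ k := Nat.cast_nonneg k
    constructor <;> linarith
  have h2 : 0 ≤ π / (2 * (2 * (n : ℝ) + 1)) := by positivity
  rw [h, abs_mul, abs_of_nonneg h2]
  exact mul_le_of_le_one_right h2 h1

theorem legendre_chebStar_constant_le (n : ℝ) (hn : 1 ≤ n) :
    1 / (3 * π * (2 * n + 1)) ≤ 1 / (6 * π * n) := by
  apply one_div_le_one_div_of_le (by positivity)
  nlinarith [pi_pos]

theorem legendre_chebOne_constant_le (n : ℝ) (hn : 1 ≤ n) :
    (3 * π ^ 2 + 2) / (6 * π * (2 * n + 1)) ≤ 0.83845 / n := by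
  have h1 := pi_gt_d6
  have h2 := pi_lt_d6
  -- The two sides differ by less than 10⁻⁵, hence the six-digit bounds on π.
  have h3 : 3 * π ^ 2 + 2 ≤ 0.83845 * (12 * π) := by nlinarith
  rw [div_le_div_iff₀ (by positivity) (by positivity)]
  nlinarith [mul_le_mul_of_nonneg_right h3 (show 0 ≤ n by linarith)]

theorem lemma2 (N : ℕ) (hN : 1 ≤ N) :
    (∃! θ : Fin N → ℝ, IsLegendreAngles N θ) ∧
    ∀ θ : Fin N → ℝ, IsLegendreAngles N θ →
      ((∀ k : Fin N, |θ k - thetaChebStar N k| ≤ 1 / (3 * Real.pi * (2 * (N : ℝ) + 1))) ∧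
        1 / (3 * Real.pi * (2 * (N : ℝ) + 1)) ≤ 1 / (6 * Real.pi * (N : ℝ))) ∧
      ((∀ k : Fin N, |θ k - thetaChebOne N k| ≤
          (3 * Real.pi ^ 2 + 2) / (6 * Real.pi * (2 * (N : ℝ) + 1))) ∧
        (3 * Real.pi ^ 2 + 2) / (6 * Real.pi * (2 * (N : ℝ) + 1)) ≤ 0.83845 / (N : ℝ)) := by
  have hN' : (1 : ℝ) ≤ N := by exact_mod_cast hN
  obtain ⟨θ₀, hθ₀⟩ := exists_isLegendreAngles N
  refine ⟨⟨θ₀, hθ₀, fun φ hφ => hφ.unique hθ₀⟩, fun θ hθ => ⟨⟨hθ.abs_sub_thetaChebStar_le,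
    legendre_chebStar_constant_le N hN'⟩, fun k => ?_, legendre_chebOne_constant_le N hN'⟩⟩
  have h1 := abs_sub_le (θ k) (thetaChebStar N k) (thetaChebOne N k)
  have h2 := hθ.abs_sub_thetaChebStar_le k
  have h3 := abs_thetaChebStar_sub_thetaChebOne_le k.2
  have h4 : (3 * π ^ 2 + 2) / (6 * π * (2 * (N : ℝ) + 1))
      = 1 / (3 * π * (2 * (N : ℝ) + 1)) + π / (2 * (2 * (N : ℝ) + 1)) := by
    field_simp
    ring
  rw [h4]
  linarith
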